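/- **Setting.** Let $X(r,\theta)=(r\cos\theta,r\sin\theta)$, let $\theta_0\in\mathbb R$, $r_*>0$, and let $r_1,r_2$ be positive continuous functions on $[\theta_0,\infty)$ with $r_2(\theta+2\pi)<r_1(\theta)<r_2(\theta)$ for all $\theta\ge\theta_0$ and $\lim_{\theta\to\infty}r_1(\theta)=\lim_{\theta\to\infty}r_2(\theta)=r_*$. Put $$U=\{X(r,\theta):\theta>\theta_0,\ r_1(\theta)<r<r_2(\theta)\},\qquad \widetilde U=\{X(r,\theta):\theta\ge\theta_0,\ r_1(\theta)\le r\le r_2(\theta)\},$$ $$\gamma=\{X(r_i(\theta),\theta):\theta\ge\theta_0,\ i=1,2\},\qquad \mathcal S_\theta=\{X(r,\theta):r_1(\theta)\le r\le r_2(\theta)\}\quad(\theta\ge\theta_0).$$ Let $A=(a_{ij})$ be a function on $U$ with values in the real symmetric $2\times2$ matrices and let $b:U\to\mathbb R^2$. Assume that there are constants $c_0,M_1>0$ and $M_2\ge0$ with $\xi^{\rm T}A(x)\xi\ge c_0|\xi|^2$, $\operatorname{Tr}A(x)\le M_1$ and $|b(x)|\le M_2$ for all $x\in U$ and $\xi\in\mathbb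 R^2$. Let $$Lu=-\sum_{i,j=1}^2a_{ij}\frac{\partial^2u}{\partial x_i\partial x_j}+b\cdot\nabla u .$$ A function $u$ on $\widetilde U$ is *below exponential growth* if $\lim_{\theta\to\infty}e^{-\varepsilon\theta}\sup_{\mathcal S_\theta}|u|=0$ for every $\varepsilon>0$. Let $g^+=\max\{0,g\}$. **Constants $C_*$ and $\nu$.** There are constants $C_*>0$ and $\nu>0$ such that the following two statements hold for all $u\in C^2(U)\cap C(\widetilde U)$. (i) If $Lu\le0$ in $U$ and $u\le0$ on $\gamma$, then, with $v=u^+$, either (a) $v(x)\le\max_{\mathcal S_{\theta_0}}v$ for all $x\in\widetilde U$ and $\max_{\mathcal S_\theta}v\le C_*\big(\max_{\mathcal S_{\theta_0}}v\big)e^{-\nu(\theta-\theta_0)}$ for all $\theta\ge\theta_0$, or (b) there are $C_1>0$ and $\bar\theta\ge\theta_0$, depending on $u$, with $\max_{\mathcal S_\theta}v\ge C_1e^{\nu(\theta-\theta_0)}$ for all $\theta\ge\bar\theta$. (ii) If $Lu=0$ in $U$ and $u=0$ on $\gamma$, then the same alternative holds with $v=|u|$. **Theorem.** With such constants $C_*$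 and $\nu$, there is a constant $K_1>0$ such that the following holds for every bounded function $f:U\to\mathbb R$ and every $u\in C^2(U)\cap C(\widetilde U)$ that is bounded on $\gamma$, is below exponential growth, and satisfies $Lu=f$ in $U$ (in particular $K_1$ does not depend on $u$ and $f$). Let $$M_B=\sup_\gamma|u|,\quad M_f=\sup_U|f|,\quad M_B(\theta)=\max_{\gamma\cap\mathcal S_\theta}|u|,\quad M_f(\theta)=\sup_{U\cap\mathcal S_\theta}|f| .$$ Then, for all $\theta\ge\theta_0$, $$\max_{\mathcal S_\theta}|u|\le M_B+K_1M_f+C_*\Big(\max_{\mathcal S_{\theta_0}}|u|+M_B+K_1M_f\Big)e^{-\nu(\theta-\theta_0)},$$ and $$\limsup_{\theta\to\infty}\Big(\max_{\mathcal S_\theta}|u|\Big)\le\limsup_{\theta\to\infty}M_B(\theta)+K_1\limsup_{\theta\to\infty}M_f(\theta).$$ -/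

import Mathlib

open Set Filter Topology

noncomputable section

/-- The plane with its Euclidean norm and inner product. -/
abbrev Plane : Type := EuclideanSpace ℝ (Fin 2)

/-- Polar coordinates `X(r, θ) = (r cos θ, r sin θ)`. -/
def polarPt (r θ : ℝ) : Plane := !₂[r * Real.cos θ, r * Real.sin θ]

/-- The data of a spiral domain: an initial angle `θ₀` and two positive continuous radii
`r₁ < r₂` on `[θ₀, ∞)`, which do not self-intersect after a full turn and which both converge
to the radius `r_* > 0` of the limit circle. -/
structure SpiralDomain where
  /-- the initial angle -/
  θ₀ : ℝ
  /-- the inner radius -/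
  r₁ : ℝ → ℝ
  /-- the outer radius -/
  r₂ : ℝ → ℝ
  /-- the radius of the limit circle -/
  rStar : ℝ
  continuousOn_r₁ : ContinuousOn r₁ (Ici θ₀)
  continuousOn_r₂ : ContinuousOn r₂ (Ici θ₀)
  r₁_pos : ∀ θ, θ₀ ≤ θ → 0 < r₁ θ
  r₂_pos : ∀ θ, θ₀ ≤ θ → 0 < r₂ θ
  r₂_turn_lt_r₁ : ∀ θ, θ₀ ≤ θ → r₂ (θ + 2 * Real.pi) < r₁ θ
  r₁_lt_r₂ : ∀ θ, θ₀ ≤ θ → r₁ θ < r₂ θ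
  rStar_pos : 0 < rStar
  tendsto_r₁ : Tendsto r₁ atTop (𝓝 rStar)
  tendsto_r₂ : Tendsto r₂ atTop (𝓝 rStar)

namespace SpiralDomain

/-- The open spiral domain `U = {X(r, θ) : θ > θ₀, r₁(θ) < r < r₂(θ)}`. -/
def U (D : SpiralDomain) : Set Plane :=
  {x | ∃ r θ : ℝ, D.θ₀ < θ ∧ D.r₁ θ < r ∧ r < D.r₂ θ ∧ x = polarPt r θ}

/-- The set `Ũ = {X(r, θ) : θ ≥ θ₀, r₁(θ) ≤ r ≤ r₂(θ)}`: the domain together with its two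
lateral curves and its initial segment, but without the limit circle. -/
def UTilde (D : SpiralDomain) : Set Plane :=
  {x | ∃ r θ : ℝ, D.θ₀ ≤ θ ∧ D.r₁ θ ≤ r ∧ r ≤ D.r₂ θ ∧ x = polarPt r θ}

/-- The lateral boundary `γ = γ₁ ∪ γ₂`, with `γᵢ = {X(rᵢ(θ), θ) : θ ≥ θ₀}`. -/
def γ (D : SpiralDomain) : Set Plane :=
  {x | ∃ θ : ℝ, D.θ₀ ≤ θ ∧ x = polarPt (D.r₁ θ) θ} ∪
    {x | ∃ θ : ℝ, D.θ₀ ≤ θ ∧ x = polarPt (D.r₂ θ) θ}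

/-- The cross-section `S_θ = {X(r, θ) : r₁(θ) ≤ r ≤ r₂(θ)}` (used for `θ ≥ θ₀`). -/
def crossSection (D : SpiralDomain) (θ : ℝ) : Set Plane :=
  {x | ∃ r : ℝ, D.r₁ θ ≤ r ∧ r ≤ D.r₂ θ ∧ x = polarPt r θ}

/-- The maximum of `g` over the cross-section `S_θ`. For `θ ≥ θ₀` the cross-section is compact
and non-empty, so for `g` continuous on `Ũ` this supremum is finite and attained. -/
def crossMax (D : SpiralDomain) (g : Plane → ℝ) (θ : ℝ) : ℝ :=
  sSup (g '' D.crossSection θ)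

/-- The regularity class `C²(U) ∩ C(Ũ)`. -/
def Regular (D : SpiralDomain) (u : Plane → ℝ) : Prop :=
  ContDiffOn ℝ 2 u D.U ∧ ContinuousOn u D.UTilde

/-- `u` is below exponential growth in `Ũ`. -/
def BelowExpGrowth (D : SpiralDomain) (u : Plane → ℝ) : Prop :=
  ∀ ε : ℝ, 0 < ε →
    Tendsto (fun θ => Real.exp (-(ε * θ)) * D.crossMax (fun x => |u x|) θ) atTop (𝓝 0)

end SpiralDomain

/-- The partial derivative `∂u/∂xᵢ`. -/
def partialD (i : Fin 2) (u : Plane → ℝ) (x : Plane) : ℝ :=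
  fderiv ℝ u x (EuclideanSpace.single i 1)

/-- The non-divergence operator
`Lu = - ∑ᵢⱼ aᵢⱼ ∂²u/∂xᵢ∂xⱼ + b · ∇u`. -/
def ellipticL (A : Plane → Matrix (Fin 2) (Fin 2) ℝ) (b : Plane → Plane)
    (u : Plane → ℝ) (x : Plane) : ℝ :=
  -(∑ i, ∑ j, A x i j * partialD i (partialD j u) x) + ∑ i, b x i * partialD i u x

/-- Symmetric coefficients on `Ω` with `ξᵀ A(x) ξ ≥ c₀ |ξ|²` and `Tr A(x) ≤ M₁`. -/
structure IsUniformlyElliptic (Ω : Set Plane) (A : Plane → Matrix (Fin 2) (Fin 2) ℝ)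
    (c₀ M₁ : ℝ) : Prop where
  c₀_pos : 0 < c₀
  M₁_pos : 0 < M₁
  symm : ∀ x ∈ Ω, (A x).IsSymm
  lower : ∀ x ∈ Ω, ∀ ξ : Plane, c₀ * ‖ξ‖ ^ 2 ≤ ∑ i, ∑ j, ξ i * A x i j * ξ j
  trace_le : ∀ x ∈ Ω, (A x).trace ≤ M₁

/-- A drift with `|b(x)| ≤ M₂` on `Ω`. -/
structure IsBoundedDrift (Ω : Set Plane) (b : Plane → Plane) (M₂ : ℝ) : Prop where
  M₂_nonneg : 0 ≤ M₂
  bound : ∀ x ∈ Ω, ‖b x‖ ≤ M₂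

namespace SpiralDomain

/-- `v`, a non-negative function standing for `u⁺` or `|u|`, is dominated by its maximum on the
initial segment and decays exponentially with the constants `C` and `ν`. -/
def Decays (D : SpiralDomain) (C ν : ℝ) (v : Plane → ℝ) : Prop :=
  (∀ x ∈ D.UTilde, v x ≤ D.crossMax v D.θ₀) ∧
    ∀ θ, D.θ₀ ≤ θ → D.crossMax v θ ≤ C * D.crossMax v D.θ₀ * Real.exp (-(ν * (θ - D.θ₀)))

/-- The maximum of `v` over the cross-sections grows at least like a multiple of
`exp (ν (θ - θ₀))`. -/
def Grows (D : SpiralDomain) (ν : ℝ) (v : Plane → ℝ) : Prop :=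
  ∃ C₁ θ₁ : ℝ, 0 < C₁ ∧ D.θ₀ ≤ θ₁ ∧
    ∀ θ, θ₁ ≤ θ → C₁ * Real.exp (ν * (θ - D.θ₀)) ≤ D.crossMax v θ

/-- `C` and `ν` are positive constants in the decay / growth dichotomy of the homogeneous
problem: for every sub-solution `u` with `u ≤ 0` on `γ`, its positive part either decays with the
constants `C, ν` or grows with the rate `ν`; and likewise `|u|` for every solution `u` with
`u = 0` on `γ`. -/
def DichotomyConstants (D : SpiralDomain) (A : Plane → Matrix (Fin 2) (Fin 2) ℝ)
    (b : Plane → Plane) (C ν : ℝ) : Prop :=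
  0 < C ∧ 0 < ν ∧
  (∀ u : Plane → ℝ, D.Regular u → (∀ x ∈ D.U, ellipticL A b u x ≤ 0) → (∀ x ∈ D.γ, u x ≤ 0) →
    D.Decays C ν (fun x => max 0 (u x)) ∨ D.Grows ν (fun x => max 0 (u x))) ∧
  (∀ u : Plane → ℝ, D.Regular u → (∀ x ∈ D.U, ellipticL A b u x = 0) → (∀ x ∈ D.γ, u x = 0) →
    D.Decays C ν (fun x => |u x|) ∨ D.Grows ν (fun x => |u x|))

/-- `M_B = sup_γ |u|`. -/
def MB (D : SpiralDomain) (u : Plane → ℝ) : ℝ := sSup ((fun x => |u x|) '' D.γ)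

/-- `M_f = sup_U |f|`. -/
def Mf (D : SpiralDomain) (f : Plane → ℝ) : ℝ := sSup ((fun x => |f x|) '' D.U)

/-- `M_B(θ) = max {|u(x)| : x ∈ γ ∩ S_θ}`. -/
def MBAt (D : SpiralDomain) (u : Plane → ℝ) (θ : ℝ) : ℝ :=
  sSup ((fun x => |u x|) '' (D.γ ∩ D.crossSection θ))

/-- `M_f(θ) = sup {|f(x)| : x ∈ U ∩ S_θ}`. -/
def MfAt (D : SpiralDomain) (f : Plane → ℝ) (θ : ℝ) : ℝ :=
  sSup ((fun x => |f x|) '' (D.U ∩ D.crossSection θ))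

end SpiralDomain

end

/-! The proof is a comparison with barriers `Ψ(θ) g(x)`, where `Ψ(θ) = α exp(νθ) + β exp(-νθ) + δ`
has non-negative coefficients and `g(x) = 2E(2E - exp(κ x₀))`. For large `κ` the term `κ² a₀₀`
outweighs the drift, so `L g ≥ 2`. The radii stay away from `0` and `∞`, and `|Ψ'| ≤ νΨ`, so
differentiating `Ψ` costs at most a multiple of `νΨ`. For small `ν` this gives `L(Ψg) ≥ Ψ`, while `1
≤ g ≤ R` (`exists_isBarrier`).

The angle is not a function on the plane, so this inequality is stated at a point of contact, with a
local branch of the angle. Comparison on `T ≤ θ ≤ T'` (`IsBarrier.two_sided_estimate`) bounds a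
sub-solution by its lateral data plus `R` times the right hand side, plus end values damped by
`exp(-ν · distance in θ)`.

Everything else comes from the choice of `T` and `T'`. If growth at rate `ν` fails, there are
arbitrarily large `T'` at which the far end contributes arbitrarily little, whence the dichotomy
with `C_* = R`. Below exponential growth, `T' → ∞` removes the far end and yields the first estimate
with `K₁ = R`. Restarting at a large `T` yields the limsup estimate. -/

/-! ### Second derivatives along lines -/

/-- A second derivative test on the line: at a local maximum the first derivative vanishes and the
second derivative is non-positive. -/
theorem IsLocalMax.deriv_eq_zero_and_second_deriv_nonpos {h h' : ℝ → ℝ} {h'' : ℝ}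
    (hmax : IsLocalMax h 0) (h1 : ∀ᶠ t in 𝓝 (0 : ℝ), HasDerivAt h (h' t) t)
    (h2 : HasDerivAt h' h'' 0) : h' 0 = 0 ∧ h'' ≤ 0 := by
  have h0 : h' 0 = 0 := hmax.hasDerivAt_eq_zero h1.self_of_nhds
  refine ⟨h0, ?_⟩
  by_contra! hpos
  have hd : deriv h =ᶠ[𝓝 0] h' := h1.mono fun t ht => ht.deriv
  have hmin : IsLocalMin h 0 := by
    apply isLocalMin_of_deriv_deriv_pos
    · rw [hd.deriv_eq, h2.deriv]; exact hpos
    · rw [hd.eq_of_nhds, h0]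
    · exact h1.self_of_nhds.continuousAt
  -- A point that is both a local maximum and a local minimum has a neighbourhood on which `h` is
  -- constant, which forces `h'' = 0`.
  have hconst : h =ᶠ[𝓝 0] fun _ => h 0 := by
    filter_upwards [hmax, hmin] with t ht1 ht2 using le_antisymm ht1 ht2
  have hz : h' =ᶠ[𝓝 0] fun _ => 0 := by
    filter_upwards [hconst.eventuallyEq_nhds, h1] with t ht1 ht2
    rw [← ht2.deriv, ht1.deriv_eq, deriv_const]
  have := (h2.congr_of_eventuallyEq hz.symm).unique (hasDerivAt_const (0 : ℝ) (0 : ℝ))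
  linarith

theorem fderiv_apply_eq_sum_partialD (u : Plane → ℝ) (x ξ : Plane) :
    fderiv ℝ u x ξ = ∑ j, ξ j * partialD j u x := by
  have : ξ = ∑ j, ξ j • (EuclideanSpace.single j (1 : ℝ) : Plane) := by
    ext i; fin_cases i <;> simp
  conv_lhs => rw [this]
  simp [partialD]

theorem hasDerivAt_line (x ξ : Plane) (t : ℝ) : HasDerivAt (fun s : ℝ => x + s • ξ) ξ t := by
  simpa using ((hasDerivAt_id t).smul_const ξ).const_add x

theorem DifferentiableAt.hasDerivAt_line {u : Plane → ℝ} {x ξ : Plane} {t : ℝ}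
    (h : DifferentiableAt ℝ u (x + t • ξ)) :
    HasDerivAt (fun s : ℝ => u (x + s • ξ)) (∑ j, ξ j * partialD j u (x + t • ξ)) t := by
  rw [← fderiv_apply_eq_sum_partialD]
  exact h.hasFDerivAt.comp_hasDerivAt t (_root_.hasDerivAt_line x ξ t)

theorem tendsto_line (x ξ : Plane) : Tendsto (fun t : ℝ => x + t • ξ) (𝓝 0) (𝓝 x) := by
  have : ContinuousAt (fun t : ℝ => x + t • ξ) 0 := (hasDerivAt_line x ξ 0).continuousAt
  simpa [ContinuousAt] using this

theorem ContDiffAt.eventually_hasDerivAt_line {u : Plane → ℝ} {x : Plane}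
    (h : ContDiffAt ℝ 2 u x) (ξ : Plane) :
    ∀ᶠ t in 𝓝 (0 : ℝ),
      HasDerivAt (fun s : ℝ => u (x + s • ξ)) (∑ j, ξ j * partialD j u (x + t • ξ)) t := by
  have h1 : ∀ᶠ y in 𝓝 x, DifferentiableAt ℝ u y :=
    (h.eventually (by simp)).mono fun y hy => hy.differentiableAt (by simp)
  filter_upwards [(tendsto_line x ξ).eventually h1] with t ht using ht.hasDerivAt_line

theorem ContDiffAt.hasDerivAt_line_second {u : Plane → ℝ} {x : Plane}
    (h : ContDiffAt ℝ 2 u x) (ξ : Plane) :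
    HasDerivAt (fun t : ℝ => ∑ j, ξ j * partialD j u (x + t • ξ))
      (∑ j, ξ j * ∑ i, ξ i * partialD i (partialD j u) x) 0 := by
  have h1 : ContDiffAt ℝ 1 (fderiv ℝ u) x := h.fderiv_right (by norm_num)
  have h2 : ∀ j, DifferentiableAt ℝ (partialD j u) x := fun j =>
    (h1.differentiableAt (by simp)).clm_apply (differentiableAt_const _)
  refine HasDerivAt.fun_sum fun j _ => ?_
  have h3 : DifferentiableAt ℝ (partialD j u) (x + (0 : ℝ) • ξ) := by simpa using h2 j
  simpa using h3.hasDerivAt_line.const_mul (ξ j)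

/-- A uniformly elliptic symmetric `2 × 2` matrix is a non-negative combination of two rank-one
matrices. -/
theorem exists_rank_one_decomposition {A : Matrix (Fin 2) (Fin 2) ℝ} {c₀ : ℝ} (hc : 0 < c₀)
    (hs : A.IsSymm) (hl : ∀ ξ : Plane, c₀ * ‖ξ‖ ^ 2 ≤ ∑ i, ∑ j, ξ i * A i j * ξ j) :
    ∃ (p q : ℝ) (ξ η : Plane), 0 ≤ p ∧ 0 ≤ q ∧
      (∀ i j, A i j = p * (ξ i * ξ j) + q * (η i * η j)) ∧
      c₀ ≤ p * ξ 0 ^ 2 + q * η 0 ^ 2 ∧ p * ‖ξ‖ ^ 2 + q * ‖η‖ ^ 2 = A.trace := by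
  have h10 : A 1 0 = A 0 1 := hs.apply 0 1
  have h00 : c₀ ≤ A 0 0 := by
    simpa [EuclideanSpace.real_norm_sq_eq] using hl !₂[1, 0]
  have hp : 0 < A 0 0 := hc.trans_le h00
  have hne := hp.ne'
  have hq : 0 ≤ A 1 1 - A 0 1 ^ 2 / A 0 0 := by
    -- This vector minimises the form among vectors with second entry `1`; the value is the Schur
    -- complement, the coefficient `q` obtained by completing the square.
    have h := hl !₂[-(A 0 1 / A 0 0), 1]
    have h' : 0 ≤ c₀ * ‖(!₂[-(A 0 1 / A 0 0), 1] : Plane)‖ ^ 2 := by positivity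
    simp only [Fin.sum_univ_two, h10] at h
    simp only [Matrix.cons_val_zero, Matrix.cons_val_one] at h
    have h2 := h'.trans h
    refine h2.trans (le_of_eq ?_)
    field_simp
    ring
  refine ⟨A 0 0, A 1 1 - A 0 1 ^ 2 / A 0 0, !₂[1, A 0 1 / A 0 0], !₂[0, 1], hp.le, hq, ?_, ?_, ?_⟩
  · intro i j
    fin_cases i <;> fin_cases j <;> simp [h10] <;> field_simp; ring
  · simpa using h00
  · simp [EuclideanSpace.real_norm_sq_eq, Matrix.trace_fin_two]
    field_simp
    ring

/-! ### Local branches of the polar angle -/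

/-- The branch near `φ` of the polar angle of `x`. -/
noncomputable def localAngle (φ : ℝ) (x : Plane) : ℝ :=
  φ + Real.arctan ((Real.cos φ * x 1 - Real.sin φ * x 0) /
    (Real.cos φ * x 0 + Real.sin φ * x 1))

theorem polarPt_norm_localAngle {φ : ℝ} {x : Plane}
    (hx : 0 < Real.cos φ * x 0 + Real.sin φ * x 1) : polarPt ‖x‖ (localAngle φ x) = x := by
  set a := Real.cos φ * x 0 + Real.sin φ * x 1 with ha
  set c := Real.cos φ * x 1 - Real.sin φ * x 0 with hc
  have hcs := Real.sin_sq_add_cos_sq φ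
  have hn : ‖x‖ = a * √(1 + (c / a) ^ 2) := by
    rw [EuclideanSpace.norm_eq, ← Real.sqrt_sq hx.le, ← Real.sqrt_mul (sq_nonneg _),
      Real.sqrt_sq hx.le]
    congr 1
    simp only [Fin.sum_univ_two, Real.norm_eq_abs, sq_abs]
    field_simp
    rw [ha, hc]
    linear_combination (-(x 0 ^ 2) - x 1 ^ 2) * hcs
  have hs : 0 < √(1 + (c / a) ^ 2) := by positivity
  ext i
  fin_cases i
  · simp only [polarPt, localAngle, hn, Real.cos_add, Real.cos_arctan, Real.sin_arctan, ← ha, ← hc]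
    simp
    field_simp
    rw [ha, hc]
    linear_combination (x 0) * hcs
  · simp only [polarPt, localAngle, hn, Real.sin_add, Real.cos_arctan, Real.sin_arctan, ← ha, ← hc]
    simp
    field_simp
    rw [ha, hc]
    linear_combination (x 1) * hcs

theorem localAngle_polarPt (r φ : ℝ) : localAngle φ (polarPt r φ) = φ := by
  simp [localAngle, polarPt]; left; ring

theorem radial_polarPt (r φ : ℝ) :
    Real.cos φ * polarPt r φ 0 + Real.sin φ * polarPt r φ 1 = r := by
  simp [polarPt]; linear_combination r * Real.sin_sq_add_cos_sq φ

theorem norm_polarPt {r : ℝ} (hr : 0 ≤ r) (φ : ℝ) : ‖polarPt r φ‖ = r := by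
  rw [EuclideanSpace.norm_eq, ← Real.sqrt_sq hr]
  congr 1
  simp [Fin.sum_univ_two, polarPt, sq_abs]
  rw [Real.sqrt_sq hr]
  linear_combination r ^ 2 * Real.sin_sq_add_cos_sq φ

theorem continuousAt_localAngle {r : ℝ} (hr : 0 < r) (φ : ℝ) :
    ContinuousAt (localAngle φ) (polarPt r φ) := by
  have h := radial_polarPt r φ
  refine continuousAt_const.add (Real.continuous_arctan.continuousAt.comp ?_)
  refine ContinuousAt.div (by fun_prop) (by fun_prop) ?_
  rw [h]; exact hr.ne'

/-- Near an interior point of polar coordinates `(r, φ)`, the points of the plane have polar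
coordinates close to `(r, φ)`. -/
theorem eventually_polar_coordinates {r φ : ℝ} (hr : 0 < r) {P : ℝ × ℝ → Prop}
    (hP : ∀ᶠ q in 𝓝 (r, φ), P q) :
    ∀ᶠ x in 𝓝 (polarPt r φ), P (‖x‖, localAngle φ x) ∧ polarPt ‖x‖ (localAngle φ x) = x := by
  have h1 : Tendsto (fun x : Plane => (‖x‖, localAngle φ x)) (𝓝 (polarPt r φ)) (𝓝 (r, φ)) := by
    have := (continuous_norm.continuousAt (x := polarPt r φ)).prodMk (continuousAt_localAngle hr φ)
    simpa [ContinuousAt, norm_polarPt hr.le, localAngle_polarPt] using this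
  have h2 : ∀ᶠ x in 𝓝 (polarPt r φ), 0 < Real.cos φ * x 0 + Real.sin φ * x 1 := by
    have hc : ContinuousAt (fun x : Plane => Real.cos φ * x 0 + Real.sin φ * x 1) (polarPt r φ) := by
      fun_prop
    exact hc.eventually_const_lt (by simpa only [radial_polarPt] using hr)
  filter_upwards [h1.eventually hP, h2] with x hx1 hx2 using ⟨hx1, polarPt_norm_localAngle hx2⟩

theorem localAngle_line (r φ t : ℝ) (ξ : Plane) :
    localAngle φ (polarPt r φ + t • ξ) =
      φ + Real.arctan (t * (Real.cos φ * ξ 1 - Real.sin φ * ξ 0) /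
        (r + t * (Real.cos φ * ξ 0 + Real.sin φ * ξ 1))) := by
  have h := radial_polarPt r φ
  unfold localAngle
  congr 3
  · simp [polarPt]; ring
  · simp only [PiLp.add_apply, PiLp.smul_apply, smul_eq_mul]; linear_combination h

/-- In the orthonormal frame at angle `φ`, the direction `ξ` has angular component `a` and radial
component `c`, with `a² + c² = |ξ|²`. Along the line the angle is `φ + arctan(ta / (r + tc))`, so
its derivatives at `0` are `a / r` and `-2ac / r²`. -/
theorem hasDerivAt_localAngle_line {r : ℝ} (hr : 0 < r) (φ : ℝ) (ξ : Plane) :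
    ∃ d : ℝ → ℝ, ∃ d2 : ℝ,
      (∀ᶠ t in 𝓝 (0 : ℝ), HasDerivAt (fun s => localAngle φ (polarPt r φ + s • ξ)) (d t) t) ∧
      HasDerivAt d d2 0 ∧ |d 0| ≤ ‖ξ‖ / r ∧ |d2| ≤ ‖ξ‖ ^ 2 / r ^ 2 := by
  set a := Real.cos φ * ξ 1 - Real.sin φ * ξ 0 with ha
  set c := Real.cos φ * ξ 0 + Real.sin φ * ξ 1 with hc
  have hac : a ^ 2 + c ^ 2 = ‖ξ‖ ^ 2 := by
    simp only [EuclideanSpace.real_norm_sq_eq, Fin.sum_univ_two, ha, hc]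
    linear_combination (ξ 0 ^ 2 + ξ 1 ^ 2) * Real.sin_sq_add_cos_sq φ
  have hpos : ∀ᶠ t in 𝓝 (0 : ℝ), 0 < r + t * c := by
    have : ContinuousAt (fun t : ℝ => r + t * c) 0 := by fun_prop
    exact this.eventually_const_lt (by simpa using hr)
  refine ⟨fun t => r * a / ((r + t * c) ^ 2 + (t * a) ^ 2), -(2 * a * c / r ^ 2), ?_, ?_, ?_, ?_⟩
  · filter_upwards [hpos] with t ht
    simp only [localAngle_line, ← ha, ← hc]
    have h1 : HasDerivAt (fun s : ℝ => s * a) a t := by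
      simpa using (hasDerivAt_id t).mul_const a
    have h2 : HasDerivAt (fun s : ℝ => r + s * c) c t := by
      simpa using ((hasDerivAt_id t).mul_const c).const_add r
    refine (((h1.fun_div h2 ht.ne').arctan).const_add φ).congr_deriv ?_
    field_simp
    ring
  · have h1 : HasDerivAt (fun s : ℝ => s * a) a 0 := by
      simpa using (hasDerivAt_id (0:ℝ)).mul_const a
    have h2 : HasDerivAt (fun s : ℝ => r + s * c) c 0 := by
      simpa using ((hasDerivAt_id (0:ℝ)).mul_const c).const_add r
    have h3 := (h2.fun_pow 2).fun_add (h1.fun_pow 2)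
    refine ((hasDerivAt_const (0:ℝ) (r * a)).fun_div h3 (by simp; exact hr.ne')).congr_deriv ?_
    simp
    field_simp
  · have hle : |a| ≤ ‖ξ‖ := by
      apply abs_le_of_sq_le_sq _ (norm_nonneg _)
      nlinarith [sq_nonneg c]
    have : r * a / ((r + 0 * c) ^ 2 + (0 * a) ^ 2) = a / r := by
      field_simp; ring
    simp only [this, abs_div, abs_of_pos hr]
    gcongr
  · rw [abs_neg, abs_div, abs_of_pos (by positivity : (0:ℝ) < r ^ 2)]
    gcongr
    rw [abs_le]
    constructor <;> nlinarith [sq_nonneg (a + c), sq_nonneg (a - c)]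

/-! ### Barrier functions and their differential inequality -/

/-- The angular factor of the barrier functions. -/
noncomputable def angularFactor (ν α β δ θ : ℝ) : ℝ :=
  α * Real.exp (ν * θ) + β * Real.exp (-(ν * θ)) + δ

/-- The factor of the barrier functions that depends on the first coordinate only. -/
noncomputable def planarFactor (κ E : ℝ) (x : Plane) : ℝ := 2 * E * (2 * E - Real.exp (κ * x 0))

theorem hasDerivAt_angularFactor (ν α β δ θ : ℝ) :
    HasDerivAt (angularFactor ν α β δ)
      (ν * (α * Real.exp (ν * θ) - β * Real.exp (-(ν * θ)))) θ := by
  have h : HasDerivAt (fun θ : ℝ => ν * θ) ν θ := by simpa using (hasDerivAt_id θ).const_mul ν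
  refine (((h.exp.const_mul α).fun_add (h.fun_neg.exp.const_mul β)).add_const δ).congr_deriv ?_
  ring

theorem hasDerivAt_angularFactor_second (ν α β θ : ℝ) :
    HasDerivAt (fun θ => ν * (α * Real.exp (ν * θ) - β * Real.exp (-(ν * θ))))
      (ν ^ 2 * (α * Real.exp (ν * θ) + β * Real.exp (-(ν * θ)))) θ := by
  have h : HasDerivAt (fun θ : ℝ => ν * θ) ν θ := by simpa using (hasDerivAt_id θ).const_mul ν
  refine (((h.exp.const_mul α).fun_sub (h.fun_neg.exp.const_mul β)).const_mul ν).congr_deriv ?_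
  ring

theorem hasDerivAt_planarFactor_line (κ E : ℝ) (x ξ : Plane) (t : ℝ) :
    HasDerivAt (fun s : ℝ => planarFactor κ E (x + s • ξ))
      (-(2 * E * κ * ξ 0) * Real.exp (κ * (x 0 + t * ξ 0))) t ∧
    HasDerivAt (fun s : ℝ => -(2 * E * κ * ξ 0) * Real.exp (κ * (x 0 + s * ξ 0)))
      (-(2 * E * κ ^ 2 * ξ 0 ^ 2) * Real.exp (κ * (x 0 + t * ξ 0))) t := by
  have h : HasDerivAt (fun s : ℝ => Real.exp (κ * (x 0 + s * ξ 0)))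
      (Real.exp (κ * (x 0 + t * ξ 0)) * (κ * ξ 0)) t := by
    have := (((hasDerivAt_id t).mul_const (ξ 0)).const_add (x 0)).const_mul κ
    simpa using this.exp
  constructor
  · simp only [planarFactor, PiLp.add_apply, PiLp.smul_apply, smul_eq_mul]
    exact ((h.const_sub (2 * E)).const_mul (2 * E)).congr_deriv (by ring)
  · exact (h.const_mul (-(2 * E * κ * ξ 0))).congr_deriv (by ring)

/-- First and second derivatives along lines of the product of an angular and a planar factor. -/
theorem barrier_line {ν α β δ κ E r φ ρ : ℝ} (hν : 0 < ν) (hν1 : ν ≤ 1) (hα : 0 ≤ α) (hβ : 0 ≤ β)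
    (hδ : 0 ≤ δ) (hκ : 0 < κ) (hρ : 0 < ρ) (hr : ρ ≤ r)
    (hE : Real.exp (κ * polarPt r φ 0) ≤ E) (ξ : Plane) :
    ∃ W : ℝ → ℝ, ∃ W2 : ℝ,
      (∀ᶠ t in 𝓝 (0 : ℝ), HasDerivAt (fun s =>
        angularFactor ν α β δ (localAngle φ (polarPt r φ + s • ξ)) *
          planarFactor κ E (polarPt r φ + s • ξ)) (W t) t) ∧
      HasDerivAt W W2 0 ∧
      W2 ≤ angularFactor ν α β δ φ * (ν * (8 * E ^ 2 / ρ ^ 2 + 4 * E ^ 2 * κ / ρ) * ‖ξ‖ ^ 2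
        - 2 * E * κ ^ 2 * Real.exp (κ * polarPt r φ 0) * ξ 0 ^ 2) ∧
      -(angularFactor ν α β δ φ * (ν * (4 * E ^ 2 / ρ) * ‖ξ‖ +
        2 * E * κ * Real.exp (κ * polarPt r φ 0) * ‖ξ‖)) ≤ W 0 := by
  obtain ⟨d, d2, hd, hd2, bd, bd2⟩ := hasDerivAt_localAngle_line (hρ.trans_le hr) φ ξ
  set x := polarPt r φ with hx
  set e := Real.exp (κ * x 0) with he
  have he0 : 0 < e := Real.exp_pos _
  have hE0 : 0 < E := he0.trans_le hE
  set a := α * Real.exp (ν * φ) with ha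
  set b := β * Real.exp (-(ν * φ)) with hb
  have ha0 : 0 ≤ a := by positivity
  have hb0 : 0 ≤ b := by positivity
  have hang0 : localAngle φ (x + (0 : ℝ) • ξ) = φ := by simp [hx, localAngle_polarPt]
  -- The product rule, once along the line and once more at `0`. Only the last summand of the second
  -- derivative, where the planar factor is differentiated twice, carries no factor `ν`.
  refine ⟨fun t => (ν * (α * Real.exp (ν * localAngle φ (x + t • ξ)) -
      β * Real.exp (-(ν * localAngle φ (x + t • ξ)))) * d t) * planarFactor κ E (x + t • ξ) +
      angularFactor ν α β δ (localAngle φ (x + t • ξ)) *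
        (-(2 * E * κ * ξ 0) * Real.exp (κ * (x 0 + t * ξ 0))),
      (ν ^ 2 * (a + b) * d 0 ^ 2 + ν * (a - b) * d2) * (2 * E * (2 * E - e)) +
        2 * (ν * (a - b) * d 0) * (-(2 * E * κ * ξ 0) * e) +
        (a + b + δ) * (-(2 * E * κ ^ 2 * ξ 0 ^ 2) * e), ?_, ?_, ?_, ?_⟩
  · filter_upwards [hd] with t ht
    exact ((hasDerivAt_angularFactor ν α β δ _).comp t ht).fun_mul
      (hasDerivAt_planarFactor_line κ E x ξ t).1
  · have hd0 := hd.self_of_nhds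
    have h1 := (hasDerivAt_angularFactor_second ν α β _).comp (0 : ℝ) hd0
    have h2 := (h1.fun_mul hd2).fun_mul (hasDerivAt_planarFactor_line κ E x ξ 0).1
    have h3 := ((hasDerivAt_angularFactor ν α β δ _).comp (0 : ℝ) hd0).fun_mul
      (hasDerivAt_planarFactor_line κ E x ξ 0).2
    refine (h2.fun_add h3).congr_deriv ?_
    simp only [Function.comp_apply, hang0]
    simp only [zero_smul, add_zero, zero_mul, angularFactor, planarFactor, ← ha, ← hb, ← he]
    ring
  · have hd' : |d 0| ≤ ‖ξ‖ / ρ := bd.trans (by gcongr)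
    have hd2' : |d2| ≤ ‖ξ‖ ^ 2 / ρ ^ 2 := bd2.trans (by gcongr)
    -- That is, `|Ψ'| ≤ νΨ`.
    have hab : |a - b| ≤ a + b + δ := by rw [abs_le]; constructor <;> linarith
    have hξ : |ξ 0| ≤ ‖ξ‖ := by simpa using PiLp.norm_apply_le ξ 0
    have hΨ : 0 ≤ a + b + δ := by positivity
    have hG : 0 ≤ 2 * E * (2 * E - e) := by nlinarith
    have hG4 : 2 * E * (2 * E - e) ≤ 4 * E ^ 2 := by nlinarith
    have t1 : ν ^ 2 * (a + b) * d 0 ^ 2 ≤ ν * (a + b + δ) * (‖ξ‖ ^ 2 / ρ ^ 2) := by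
      have : d 0 ^ 2 ≤ ‖ξ‖ ^ 2 / ρ ^ 2 := by
        rw [← sq_abs, ← div_pow]; gcongr
      -- With `ν ≤ 1`, a single factor `ν` serves for all error terms.
      have : ν ^ 2 ≤ ν := by nlinarith
      have h3 : a + b ≤ a + b + δ := by linarith
      exact mul_le_mul (mul_le_mul ‹_› h3 (by positivity) hν.le) ‹_› (sq_nonneg _) (by positivity)
    have t2 : ν * (a - b) * d2 ≤ ν * (a + b + δ) * (‖ξ‖ ^ 2 / ρ ^ 2) := by
      refine (le_abs_self _).trans ?_
      rw [abs_mul, abs_mul, abs_of_pos hν]; gcongr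
    have t3 : 2 * (ν * (a - b) * d 0) * (-(2 * E * κ * ξ 0) * e) ≤
        2 * (ν * (a + b + δ) * (‖ξ‖ / ρ)) * (2 * E * κ * ‖ξ‖ * E) := by
      refine (le_abs_self _).trans ?_
      simp only [abs_mul, abs_neg, abs_of_pos hν, abs_of_pos hE0, abs_of_pos hκ, abs_of_pos he0,
        abs_two]
      gcongr
    have t4 : (ν ^ 2 * (a + b) * d 0 ^ 2 + ν * (a - b) * d2) * (2 * E * (2 * E - e)) ≤
        (2 * (ν * (a + b + δ) * (‖ξ‖ ^ 2 / ρ ^ 2))) * (4 * E ^ 2) := by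
      refine (mul_le_mul_of_nonneg_right (by linarith) hG).trans
        (mul_le_mul_of_nonneg_left hG4 (by positivity))
    unfold angularFactor
    rw [← ha, ← hb]
    refine (add_le_add (add_le_add t4 t3) le_rfl).trans (le_of_eq ?_)
    field_simp
    ring
  · have hd' : |d 0| ≤ ‖ξ‖ / ρ := bd.trans (by gcongr)
    have hab : |a - b| ≤ a + b + δ := by rw [abs_le]; constructor <;> linarith
    have hξ : |ξ 0| ≤ ‖ξ‖ := by simpa using PiLp.norm_apply_le ξ 0
    have hΨ : 0 ≤ a + b + δ := by positivity
    have hG : 0 ≤ 2 * E * (2 * E - e) := by nlinarith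
    have hG4 : 2 * E * (2 * E - e) ≤ 4 * E ^ 2 := by nlinarith
    have t1 : |ν * (a - b) * d 0 * (2 * E * (2 * E - e))| ≤
        ν * (a + b + δ) * (‖ξ‖ / ρ) * (4 * E ^ 2) := by
      rw [abs_mul, abs_mul, abs_mul, abs_of_pos hν, abs_of_nonneg hG]; gcongr
    have t2 : |(a + b + δ) * (-(2 * E * κ * ξ 0) * e)| ≤
        (a + b + δ) * (2 * E * κ * ‖ξ‖ * e) := by
      simp only [abs_mul, abs_neg, abs_of_pos hE0, abs_of_pos hκ, abs_of_pos he0,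
        abs_two, abs_of_nonneg hΨ]
      gcongr
    simp only [hang0]
    simp only [zero_smul, add_zero, zero_mul, angularFactor, planarFactor, ← ha, ← hb, ← he]
    have e1 := neg_abs_le (ν * (a - b) * d 0 * (2 * E * (2 * E - e)))
    have e2 := neg_abs_le ((a + b + δ) * (-(2 * E * κ * ξ 0) * e))
    refine le_trans (le_of_eq ?_) (add_le_add ((neg_le_neg t1).trans e1) ((neg_le_neg t2).trans e2))
    field_simp
    ring

/-- The differential inequality of the barrier functions, in the form of a touching condition. -/
theorem angularFactor_le_ellipticL {A : Plane → Matrix (Fin 2) (Fin 2) ℝ} {b : Plane → Plane}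
    {Ω : Set Plane} {c₀ M₁ M₂ ν α β δ κ E r φ ρ : ℝ} {u : Plane → ℝ}
    (hA : IsUniformlyElliptic Ω A c₀ M₁) (hb : IsBoundedDrift Ω b M₂)
    (hν : 0 < ν) (hν1 : ν ≤ 1) (hα : 0 ≤ α) (hβ : 0 ≤ β) (hδ : 0 ≤ δ) (hκ : 1 ≤ κ)
    (hκc : M₂ + 1 ≤ κ * c₀) (hρ : 0 < ρ) (hr : ρ ≤ r)
    (hE : Real.exp (κ * polarPt r φ 0) ≤ E) (hE' : 1 ≤ E * Real.exp (κ * polarPt r φ 0))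
    (hνs : ν * ((8 * E ^ 2 / ρ ^ 2 + 4 * E ^ 2 * κ / ρ) * M₁ + 4 * E ^ 2 / ρ * M₂) ≤ 1)
    (hx : polarPt r φ ∈ Ω) (hu : ContDiffAt ℝ 2 u (polarPt r φ))
    (hmax : IsLocalMax (fun x => u x - angularFactor ν α β δ (localAngle φ x) *
      planarFactor κ E x) (polarPt r φ)) :
    angularFactor ν α β δ φ ≤ ellipticL A b u (polarPt r φ) := by
  set x := polarPt r φ with hxdef
  set e := Real.exp (κ * x 0) with he
  have he0 : 0 < e := Real.exp_pos _
  have hE0 : 0 < E := he0.trans_le hE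
  set Ψ := angularFactor ν α β δ φ with hΨdef
  have hΨ : 0 ≤ Ψ := by rw [hΨdef, angularFactor]; positivity
  set Q := 8 * E ^ 2 / ρ ^ 2 + 4 * E ^ 2 * κ / ρ with hQ
  have hκ0 : 0 < κ := by linarith
  have hQ0 : 0 ≤ Q := by positivity
  -- At the contact point `u` has the first derivatives of the barrier and no larger second
  -- directional derivatives. The second order bound is used for the two directions that compose
  -- `A`, the first order bound for the direction `b x`.
  have key : ∀ ξ : Plane,
      -(Ψ * (ν * (4 * E ^ 2 / ρ) * ‖ξ‖ + 2 * E * κ * e * ‖ξ‖)) ≤ ∑ j, ξ j * partialD j u x ∧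
      ∑ j, ξ j * ∑ i, ξ i * partialD i (partialD j u) x ≤
        Ψ * (ν * Q * ‖ξ‖ ^ 2 - 2 * E * κ ^ 2 * e * ξ 0 ^ 2) := by
    intro ξ
    obtain ⟨W, W2, hW, hW2, b2, b1⟩ := barrier_line hν hν1 hα hβ hδ hκ0 hρ hr hE ξ
    have hl : IsLocalMax (fun t : ℝ => u (x + t • ξ) -
        angularFactor ν α β δ (localAngle φ (x + t • ξ)) * planarFactor κ E (x + t • ξ)) 0 := by
      have := (tendsto_line x ξ).eventually hmax
      simpa [IsLocalMax, IsMaxFilter] using this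
    have h1 : ∀ᶠ t in 𝓝 (0 : ℝ), HasDerivAt (fun t : ℝ => u (x + t • ξ) -
        angularFactor ν α β δ (localAngle φ (x + t • ξ)) * planarFactor κ E (x + t • ξ))
        (∑ j, ξ j * partialD j u (x + t • ξ) - W t) t := by
      filter_upwards [hu.eventually_hasDerivAt_line ξ, hW] with t ht1 ht2 using ht1.fun_sub ht2
    obtain ⟨g1, g2⟩ := hl.deriv_eq_zero_and_second_deriv_nonpos h1
      ((hu.hasDerivAt_line_second ξ).fun_sub hW2)
    constructor
    · have : ∑ j, ξ j * partialD j u x = W 0 := by simpa [sub_eq_zero] using g1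
      rw [this]; exact b1
    · exact (sub_nonpos.1 g2).trans b2
  obtain ⟨p, q, ξ, η, hp, hq, hdec, hlow, htr⟩ :=
    exists_rank_one_decomposition hA.c₀_pos (hA.symm x hx) (hA.lower x hx)
  have hsum : ∑ i, ∑ j, A x i j * partialD i (partialD j u) x =
      p * ∑ j, ξ j * ∑ i, ξ i * partialD i (partialD j u) x +
      q * ∑ j, η j * ∑ i, η i * partialD i (partialD j u) x := by
    simp only [hdec, Fin.sum_univ_two]; ring
  have k1 := mul_le_mul_of_nonneg_left (key ξ).2 hp
  have k2 := mul_le_mul_of_nonneg_left (key η).2 hq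
  have k3 := (key (b x)).1
  have hbx := hb.bound x hx
  have htr' : p * ‖ξ‖ ^ 2 + q * ‖η‖ ^ 2 ≤ M₁ := htr.trans_le (hA.trace_le x hx)
  have k4 : p * (Ψ * (ν * Q * ‖ξ‖ ^ 2 - 2 * E * κ ^ 2 * e * ξ 0 ^ 2)) +
      q * (Ψ * (ν * Q * ‖η‖ ^ 2 - 2 * E * κ ^ 2 * e * η 0 ^ 2)) ≤
      Ψ * (ν * Q * M₁ - 2 * E * κ ^ 2 * e * c₀) := by
    have e1 : ν * Q * (p * ‖ξ‖ ^ 2 + q * ‖η‖ ^ 2) ≤ ν * Q * M₁ :=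
      mul_le_mul_of_nonneg_left htr' (by positivity)
    have e2 : 2 * E * κ ^ 2 * e * c₀ ≤ 2 * E * κ ^ 2 * e * (p * ξ 0 ^ 2 + q * η 0 ^ 2) :=
      mul_le_mul_of_nonneg_left hlow (by positivity)
    have := mul_le_mul_of_nonneg_left (sub_le_sub e1 e2) hΨ
    linarith
  have k5 : Ψ * (ν * (4 * E ^ 2 / ρ) * ‖b x‖ + 2 * E * κ * e * ‖b x‖) ≤
      Ψ * (ν * (4 * E ^ 2 / ρ) * M₂ + 2 * E * κ * e * M₂) := by gcongr
  -- This is `L g ≥ 2`: the expression is `2(E e) · κ(κ c₀ - M₂)`, and both `E e` and `κ(κ c₀ - M₂)`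
  -- are at least `1`. The smallness of `ν` then costs at most `1`.
  have k6 : 2 ≤ 2 * E * κ ^ 2 * e * c₀ - 2 * E * κ * e * M₂ := by
    have : 1 ≤ κ * (κ * c₀ - M₂) := by nlinarith
    nlinarith
  have k7 : Ψ * 1 ≤ Ψ * ((2 * E * κ ^ 2 * e * c₀ - 2 * E * κ * e * M₂) -
      ν * (Q * M₁ + 4 * E ^ 2 / ρ * M₂)) := mul_le_mul_of_nonneg_left (by linarith) hΨ
  unfold ellipticL
  rw [hsum]
  linarith

/-! ### Uniform barriers on the spiral -/

theorem ContinuousOn.exists_upper_bound_of_tendsto {f : ℝ → ℝ} {a l : ℝ}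
    (hf : ContinuousOn f (Ici a)) (hl : Tendsto f atTop (𝓝 l)) : ∃ M, ∀ θ, a ≤ θ → f θ ≤ M := by
  obtain ⟨T, hT⟩ := eventually_atTop.1 (hl.eventually_le_const (lt_add_one l))
  obtain ⟨M, hM⟩ := (isCompact_Icc.image_of_continuousOn
    (hf.mono (Icc_subset_Ici_self : Icc a T ⊆ Ici a))).bddAbove
  refine ⟨max M (l + 1), fun θ hθ => ?_⟩
  rcases le_total T θ with h | h
  · exact (hT θ h).trans (le_max_right _ _)
  · exact (hM ⟨θ, ⟨hθ, h⟩, rfl⟩).trans (le_max_left _ _)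

namespace SpiralDomain

theorem exists_radius_bounds (D : SpiralDomain) :
    ∃ ρ ρ' : ℝ, 0 < ρ ∧ 0 < ρ' ∧ ∀ θ, D.θ₀ ≤ θ → ρ ≤ D.r₁ θ ∧ D.r₂ θ ≤ ρ' := by
  obtain ⟨M, hM⟩ := D.continuousOn_r₂.exists_upper_bound_of_tendsto D.tendsto_r₂
  -- The lower bound for `r₁` is an upper bound for its inverse, which has a limit because `r_* >
  -- 0`.
  obtain ⟨N, hN⟩ := (D.continuousOn_r₁.inv₀ fun θ hθ =>
    (D.r₁_pos θ hθ).ne').exists_upper_bound_of_tendsto (D.tendsto_r₁.inv₀ D.rStar_pos.ne')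
  have hN0 : 0 < N := (inv_pos.2 (D.r₁_pos _ le_rfl)).trans_le (hN _ le_rfl)
  refine ⟨N⁻¹, M, inv_pos.2 hN0, (D.r₂_pos _ le_rfl).trans_le (hM _ le_rfl), fun θ hθ =>
    ⟨inv_le_of_inv_le₀ (D.r₁_pos θ hθ) (hN θ hθ), hM θ hθ⟩⟩

/-- An interior point in polar coordinates is surrounded by interior points. -/
theorem eventually_interior (D : SpiralDomain) {T r φ : ℝ} {T' : WithTop ℝ} (hT : D.θ₀ ≤ T)
    (h1 : T < φ) (h1' : (φ : WithTop ℝ) < T') (h2 : D.r₁ φ < r) (h3 : r < D.r₂ φ) :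
    ∀ᶠ x in 𝓝 (polarPt r φ), (T < localAngle φ x ∧ ((localAngle φ x : ℝ) : WithTop ℝ) < T' ∧
      D.r₁ (localAngle φ x) < ‖x‖ ∧ ‖x‖ < D.r₂ (localAngle φ x)) ∧
      polarPt ‖x‖ (localAngle φ x) = x := by
  have hφ : D.θ₀ < φ := hT.trans_lt h1
  have hr : 0 < r := (D.r₁_pos φ hφ.le).trans h2
  have c1 : ContinuousAt (fun q : ℝ × ℝ => D.r₁ q.2) (r, φ) :=
    ContinuousAt.comp (f := Prod.snd) (x := (r, φ))
      (D.continuousOn_r₁.continuousAt (Ici_mem_nhds hφ)) continuousAt_snd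
  have c2 : ContinuousAt (fun q : ℝ × ℝ => D.r₂ q.2) (r, φ) :=
    ContinuousAt.comp (f := Prod.snd) (x := (r, φ))
      (D.continuousOn_r₂.continuousAt (Ici_mem_nhds hφ)) continuousAt_snd
  have cs : Tendsto (Prod.snd : ℝ × ℝ → ℝ) (𝓝 (r, φ)) (𝓝 φ) := continuousAt_snd
  -- The value `⊤` covers the whole domain `U`, a finite `T'` a bounded portion of it.
  have c3 : ∀ᶠ q : ℝ × ℝ in 𝓝 (r, φ), (q.2 : WithTop ℝ) < T' := by
    induction T' using WithTop.recTopCoe with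
    | top => exact Eventually.of_forall fun q => WithTop.coe_lt_top _
    | coe S =>
      simp only [WithTop.coe_lt_coe] at h1' ⊢
      exact cs.eventually_lt_const h1'
  exact eventually_polar_coordinates (P := fun q => T < q.2 ∧ (q.2 : WithTop ℝ) < T' ∧
      D.r₁ q.2 < q.1 ∧ q.1 < D.r₂ q.2) hr
    ((cs.eventually_const_lt h1).and (c3.and
      ((c1.eventually_lt continuousAt_fst h2).and (continuousAt_fst.eventually_lt c2 h3))))

theorem U_mem_nhds (D : SpiralDomain) {r φ : ℝ} (h1 : D.θ₀ < φ) (h2 : D.r₁ φ < r)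
    (h3 : r < D.r₂ φ) : D.U ∈ 𝓝 (polarPt r φ) := by
  filter_upwards [D.eventually_interior le_rfl h1 (WithTop.coe_lt_top φ) h2 h3]
    with x ⟨⟨a1, _, a2, a3⟩, a4⟩ using ⟨_, _, a1, a2, a3, a4.symm⟩

/-- The function `g` together with the exponential rate `ν` provides barriers for the operator:
a function `u` that touches `(α exp (ν θ) + β exp (-ν θ) + δ) g` from below (up to a constant)
has `L u ≥ α exp (ν θ) + β exp (-ν θ) + δ` at the point of contact. -/
structure IsBarrier (D : SpiralDomain) (A : Plane → Matrix (Fin 2) (Fin 2) ℝ) (b : Plane → Plane)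
    (R ν : ℝ) (g : Plane → ℝ) : Prop where
  one_le : 1 ≤ R
  rate_pos : 0 < ν
  cont : Continuous g
  lower : ∀ x ∈ D.UTilde, 1 ≤ g x
  upper : ∀ x ∈ D.UTilde, g x ≤ R
  touching : ∀ (α β δ : ℝ) (u : Plane → ℝ) (r φ : ℝ), 0 ≤ α → 0 ≤ β → 0 ≤ δ →
    ContDiffOn ℝ 2 u D.U → D.θ₀ < φ → D.r₁ φ < r → r < D.r₂ φ →
    IsLocalMax (fun x => u x - angularFactor ν α β δ (localAngle φ x) * g x) (polarPt r φ) →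
    angularFactor ν α β δ φ ≤ ellipticL A b u (polarPt r φ)

theorem exists_isBarrier (D : SpiralDomain) {A : Plane → Matrix (Fin 2) (Fin 2) ℝ}
    {b : Plane → Plane} {c₀ M₁ M₂ : ℝ} (hA : IsUniformlyElliptic D.U A c₀ M₁)
    (hb : IsBoundedDrift D.U b M₂) : ∃ R ν g, D.IsBarrier A b R ν g := by
  obtain ⟨ρ, ρ', hρ, hρ', hD⟩ := D.exists_radius_bounds
  have hc := hA.c₀_pos
  have hM1 := hA.M₁_pos
  have hM2 := hb.M₂_nonneg
  set κ := 1 + (M₂ + 1) / c₀ with hκ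
  have hκ1 : 1 ≤ κ := by rw [hκ]; have : 0 ≤ (M₂ + 1) / c₀ := by positivity
                         linarith
  have hκc : M₂ + 1 ≤ κ * c₀ := by
    rw [hκ, add_mul, div_mul_cancel₀ _ hc.ne']; linarith
  -- Since `|x₀| ≤ ρ'`, this bounds both `exp(κ x₀)` and its inverse.
  set E := Real.exp (κ * ρ') with hE
  have hE1 : 1 ≤ E := Real.one_le_exp (by positivity)
  set N := (8 * E ^ 2 / ρ ^ 2 + 4 * E ^ 2 * κ / ρ) * M₁ + 4 * E ^ 2 / ρ * M₂ with hN
  have hN0 : 0 ≤ N := by positivity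
  have hx0 : ∀ r θ, D.θ₀ ≤ θ → D.r₁ θ ≤ r → r ≤ D.r₂ θ → |polarPt r θ 0| ≤ ρ' := by
    intro r θ h1 h2 h3
    have hr : 0 ≤ r := (D.r₁_pos θ h1).le.trans h2
    have := PiLp.norm_apply_le (polarPt r θ) 0
    rw [norm_polarPt hr] at this
    exact this.trans (h3.trans (hD θ h1).2)
  have he : ∀ r θ, D.θ₀ ≤ θ → D.r₁ θ ≤ r → r ≤ D.r₂ θ →
      Real.exp (κ * polarPt r θ 0) ≤ E ∧ 1 ≤ E * Real.exp (κ * polarPt r θ 0) := by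
    intro r θ h1 h2 h3
    obtain ⟨a1, a2⟩ := abs_le.1 (hx0 r θ h1 h2 h3)
    refine ⟨Real.exp_le_exp.2 (by gcongr), ?_⟩
    rw [hE, ← Real.exp_add]
    refine Real.one_le_exp ?_
    have : 0 ≤ κ * (ρ' + polarPt r θ 0) := mul_nonneg (by linarith) (by linarith)
    linarith
  -- `N` collects the error terms, so that `νN ≤ 1`; the summand `1` ensures `ν ≤ 1`.
  refine ⟨4 * E ^ 2, 1 / (1 + N), planarFactor κ E, ?_, by positivity, ?_, ?_, ?_, ?_⟩
  · nlinarith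
  · unfold planarFactor; fun_prop
  · rintro x ⟨r, θ, h1, h2, h3, rfl⟩
    have := (he r θ h1 h2 h3).1
    unfold planarFactor
    nlinarith
  · rintro x ⟨r, θ, h1, h2, h3, rfl⟩
    have := Real.exp_pos (κ * polarPt r θ 0)
    unfold planarFactor
    nlinarith
  · intro α β δ u r φ hα hβ hδ hu h1 h2 h3 hmax
    obtain ⟨e1, e2⟩ := he r φ h1.le h2.le h3.le
    refine angularFactor_le_ellipticL hA hb (by positivity) ?_ hα hβ hδ hκ1 hκc hρ
      ((hD φ h1.le).1.trans h2.le) e1 e2 ?_ ⟨r, φ, h1, h2, h3, rfl⟩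
      (hu.contDiffAt (D.U_mem_nhds h1 h2 h3)) hmax
    · rw [div_le_one (by linarith)]; linarith
    · rw [← hN, one_div_mul_eq_div, div_le_one (by linarith)]; linarith

variable {D : SpiralDomain} {A : Plane → Matrix (Fin 2) (Fin 2) ℝ} {b : Plane → Plane}
  {R ν : ℝ} {g : Plane → ℝ}

/-! ### Comparison on finite portions -/

/-- The maximum principle for the difference of a function and a barrier, on a finite portion of
the spiral. -/
theorem IsBarrier.maximum_principle (hg : D.IsBarrier A b R ν g) {u : Plane → ℝ}
    (hu : D.Regular u) {T T' α β δ k : ℝ} (hT : D.θ₀ ≤ T) (hα : 0 ≤ α) (hβ : 0 ≤ β) (hδ : 0 ≤ δ)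
    (hL : ∀ r φ, T < φ → D.r₁ φ < r → r < D.r₂ φ →
      ellipticL A b u (polarPt r φ) < angularFactor ν α β δ φ)
    (hin : ∀ φ, T ≤ φ → φ ≤ T' →
      u (polarPt (D.r₁ φ) φ) - angularFactor ν α β δ φ * g (polarPt (D.r₁ φ) φ) ≤ k)
    (hout : ∀ φ, T ≤ φ → φ ≤ T' →
      u (polarPt (D.r₂ φ) φ) - angularFactor ν α β δ φ * g (polarPt (D.r₂ φ) φ) ≤ k)
    (hstart : ∀ r, D.r₁ T ≤ r → r ≤ D.r₂ T →
      u (polarPt r T) - angularFactor ν α β δ T * g (polarPt r T) ≤ k)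
    (hend : ∀ r, D.r₁ T' ≤ r → r ≤ D.r₂ T' →
      u (polarPt r T') - angularFactor ν α β δ T' * g (polarPt r T') ≤ k)
    {r φ : ℝ} (h1 : T ≤ φ) (h2 : φ ≤ T') (h3 : D.r₁ φ ≤ r) (h4 : r ≤ D.r₂ φ) :
    u (polarPt r φ) - angularFactor ν α β δ φ * g (polarPt r φ) ≤ k := by
  -- The portion is parametrised by a compact rectangle, on which the angle is a genuine coordinate
  -- and the maximum is attained.
  set ϱ : ℝ × ℝ → ℝ := fun q => D.r₁ q.2 + q.1 * (D.r₂ q.2 - D.r₁ q.2) with hϱ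
  set K : Set (ℝ × ℝ) := Icc 0 1 ×ˢ Icc T T' with hK
  set z : ℝ × ℝ → ℝ := fun q => u (polarPt (ϱ q) q.2) -
    angularFactor ν α β δ q.2 * g (polarPt (ϱ q) q.2) with hz
  have hϱb : ∀ q ∈ K, D.r₁ q.2 ≤ ϱ q ∧ ϱ q ≤ D.r₂ q.2 := by
    rintro ⟨s, θ⟩ ⟨⟨s0, s1⟩, t0, t1⟩
    have := D.r₁_lt_r₂ θ (hT.trans t0)
    constructor <;> simp only [hϱ] <;> nlinarith
  have hsnd : MapsTo Prod.snd K (Ici D.θ₀) := fun q hq => hT.trans hq.2.1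
  have cr1 : ContinuousOn (fun q : ℝ × ℝ => D.r₁ q.2) K :=
    D.continuousOn_r₁.comp continuousOn_snd hsnd
  have cr2 : ContinuousOn (fun q : ℝ × ℝ => D.r₂ q.2) K :=
    D.continuousOn_r₂.comp continuousOn_snd hsnd
  have cϱ : ContinuousOn ϱ K := cr1.add (continuousOn_fst.mul (cr2.sub cr1))
  have cX : ContinuousOn (fun q => polarPt (ϱ q) q.2) K := by
    have : Continuous (fun p : ℝ × ℝ => polarPt p.1 p.2) := by
      unfold polarPt
      refine (PiLp.continuous_toLp 2 _).comp ?_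
      fun_prop
    exact this.comp_continuousOn (cϱ.prodMk continuousOn_snd)
  have cΨ : Continuous (angularFactor ν α β δ) := by unfold angularFactor; fun_prop
  have cz : ContinuousOn z K := by
    refine (hu.2.comp cX fun q hq => ⟨ϱ q, q.2, hsnd hq, (hϱb q hq).1, (hϱb q hq).2, rfl⟩).sub
      ((cΨ.comp_continuousOn continuousOn_snd).mul (hg.cont.comp_continuousOn cX))
  have hrep : ∀ r φ, T ≤ φ → φ ≤ T' → D.r₁ φ ≤ r → r ≤ D.r₂ φ →
      ∃ q ∈ K, ϱ q = r ∧ q.2 = φ := by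
    intro r φ h1 h2 h3 h4
    have hlt := sub_pos.2 (D.r₁_lt_r₂ φ (hT.trans h1))
    refine ⟨((r - D.r₁ φ) / (D.r₂ φ - D.r₁ φ), φ), ⟨⟨?_, ?_⟩, h1, h2⟩, ?_, rfl⟩
    · exact div_nonneg (sub_nonneg.2 h3) hlt.le
    · exact (div_le_one hlt).2 (by linarith)
    · simp only [hϱ]; rw [div_mul_cancel₀ _ hlt.ne']; ring
  obtain ⟨q', hq', hq1, hq2⟩ := hrep r φ h1 h2 h3 h4
  obtain ⟨q, hq, hmax⟩ := (isCompact_Icc.prod isCompact_Icc).exists_isMaxOn ⟨q', hq'⟩ cz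
  have hle : ∀ r φ, T ≤ φ → φ ≤ T' → D.r₁ φ ≤ r → r ≤ D.r₂ φ →
      u (polarPt r φ) - angularFactor ν α β δ φ * g (polarPt r φ) ≤ z q := by
    intro r φ h1 h2 h3 h4
    obtain ⟨p, hp, rfl, rfl⟩ := hrep r φ h1 h2 h3 h4
    exact hmax hp
  refine (hle r φ h1 h2 h3 h4).trans ?_
  obtain ⟨s, θ⟩ := q
  obtain ⟨b1, b2⟩ := hϱb _ hq
  obtain ⟨-, t0, t1⟩ := hq
  simp only at b1 b2 t0 t1
  rcases t0.eq_or_lt with rfl | t0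
  · exact hstart _ b1 b2
  rcases t1.eq_or_lt with rfl | t1
  · exact hend _ b1 b2
  rcases b1.eq_or_lt with e | b1
  · simp only [hz, ← e]; exact hin _ t0.le t1.le
  rcases b2.eq_or_lt with e | b2
  · simp only [hz, e]; exact hout _ t0.le t1.le
  -- A maximum in the interior of the rectangle is a local maximum in the plane, so the touching
  -- condition contradicts the strict inequality for `L u`.
  refine absurd (hL _ θ t0 b1 b2) (not_lt.2 (hg.touching α β δ u _ θ hα hβ hδ hu.1
    (hT.trans_lt t0) b1 b2 ?_))
  filter_upwards [D.eventually_interior hT t0 (WithTop.coe_lt_coe.2 t1) b1 b2]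
    with x ⟨⟨a1, a2, a3, a4⟩, a5⟩
  have := hle _ _ a1.le (WithTop.coe_lt_coe.1 a2).le a3.le a4.le
  rw [a5] at this
  rw [localAngle_polarPt]
  exact this

/-- A sub-solution on the portion `T ≤ θ ≤ T'` of the spiral is controlled by its lateral boundary
values, the right hand side and, with exponentially decaying weights, the values at both ends. -/
theorem IsBarrier.two_sided_estimate (hg : D.IsBarrier A b R ν g) {u : Plane → ℝ}
    (hu : D.Regular u) {T T' k F m m' : ℝ} (hT : D.θ₀ ≤ T) (hF : 0 ≤ F) (hm : 0 ≤ m)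
    (hm' : 0 ≤ m')
    (hL : ∀ r φ, T < φ → D.r₁ φ < r → r < D.r₂ φ → ellipticL A b u (polarPt r φ) ≤ F)
    (hin : ∀ φ, T ≤ φ → u (polarPt (D.r₁ φ) φ) ≤ k)
    (hout : ∀ φ, T ≤ φ → u (polarPt (D.r₂ φ) φ) ≤ k)
    (hstart : ∀ r, D.r₁ T ≤ r → r ≤ D.r₂ T → u (polarPt r T) ≤ k + m)
    (hend : ∀ r, D.r₁ T' ≤ r → r ≤ D.r₂ T' → u (polarPt r T') ≤ k + m')
    {r φ : ℝ} (h1 : T ≤ φ) (h2 : φ ≤ T') (h3 : D.r₁ φ ≤ r) (h4 : r ≤ D.r₂ φ) :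
    u (polarPt r φ) ≤ k + R * F + R * m * Real.exp (-(ν * (φ - T))) +
      R * m' * Real.exp (-(ν * (T' - φ))) := by
  have hR : 0 < R := by linarith [hg.one_le]
  refine le_of_forall_pos_le_add fun ε hε => ?_
  -- The growing exponential equals `m'` at `T'` and the decaying one equals `m` at `T`. The
  -- constant term `F + ε / R` makes the inequality for `L u` strict, at a cost of at most `ε` since
  -- `g ≤ R`.
  set α := m' * Real.exp (-(ν * T')) with hα
  set β := m * Real.exp (ν * T) with hβ
  have hα0 : 0 ≤ α := by positivity
  have hβ0 : 0 ≤ β := by positivity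
  have hεR : 0 < ε / R := by positivity
  set Ψ := angularFactor ν α β (F + ε / R) with hΨ
  have hlow : ∀ φ, F + ε / R ≤ Ψ φ := by
    intro φ
    have : 0 ≤ α * Real.exp (ν * φ) + β * Real.exp (-(ν * φ)) := by positivity
    simp only [hΨ, angularFactor]; linarith
  have hpos : ∀ φ, 0 ≤ Ψ φ := fun φ => (by positivity : 0 ≤ F + ε / R).trans (hlow φ)
  have hform : ∀ φ, Ψ φ = m' * Real.exp (-(ν * (T' - φ))) + m * Real.exp (-(ν * (φ - T))) +
      (F + ε / R) := by
    intro φ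
    simp only [hΨ, angularFactor, hα, hβ, mul_assoc, ← Real.exp_add]
    ring_nf
  have hΨT : m ≤ Ψ T := by
    rw [hform, sub_self, mul_zero, neg_zero, Real.exp_zero, mul_one]
    have : 0 ≤ m' * Real.exp (-(ν * (T' - T))) := by positivity
    linarith
  have hΨT' : m' ≤ Ψ T' := by
    rw [hform, sub_self, mul_zero, neg_zero, Real.exp_zero, mul_one]
    have : 0 ≤ m * Real.exp (-(ν * (T' - T))) := by positivity
    linarith
  have hgl : ∀ r φ, T ≤ φ → D.r₁ φ ≤ r → r ≤ D.r₂ φ →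
      1 ≤ g (polarPt r φ) ∧ g (polarPt r φ) ≤ R := fun r φ a1 a2 a3 =>
    ⟨hg.lower _ ⟨r, φ, hT.trans a1, a2, a3, rfl⟩, hg.upper _ ⟨r, φ, hT.trans a1, a2, a3, rfl⟩⟩
  have hprod : ∀ r φ, T ≤ φ → D.r₁ φ ≤ r → r ≤ D.r₂ φ → Ψ φ ≤ Ψ φ * g (polarPt r φ) :=
    fun r φ a1 a2 a3 => le_mul_of_one_le_right (hpos φ) (hgl r φ a1 a2 a3).1
  have hr12 : ∀ φ, T ≤ φ → D.r₁ φ ≤ D.r₂ φ := fun φ hφ => (D.r₁_lt_r₂ φ (hT.trans hφ)).le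
  have key := hg.maximum_principle hu (T' := T') (k := k) hT hα0 hβ0
    (by positivity : 0 ≤ F + ε / R)
    (fun r φ a1 a2 a3 => (hL r φ a1 a2 a3).trans_lt (by
      have := hlow φ
      simp only [hΨ] at this
      linarith))
    (fun φ a1 _ => by linarith [hin φ a1, hprod _ φ a1 le_rfl (hr12 φ a1), hpos φ])
    (fun φ a1 _ => by linarith [hout φ a1, hprod _ φ a1 (hr12 φ a1) le_rfl, hpos φ])
    (fun r a1 a2 => by linarith [hstart r a1 a2, hprod _ T le_rfl a1 a2])
    (fun r a1 a2 => by linarith [hend r a1 a2, hprod _ T' (h1.trans h2) a1 a2])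
    h1 h2 h3 h4
  have hfin : Ψ φ * g (polarPt r φ) ≤ R * Ψ φ := by
    rw [mul_comm]; exact mul_le_mul_of_nonneg_right (hgl r φ h1 h3 h4).2 (hpos φ)
  have hexp : R * Ψ φ = R * F + R * m * Real.exp (-(ν * (φ - T))) +
      R * m' * Real.exp (-(ν * (T' - φ))) + ε := by
    rw [hform]; field_simp; ring
  linarith

end SpiralDomain

/-! ### Sign change and maxima over cross-sections -/

theorem ellipticL_neg (A : Plane → Matrix (Fin 2) (Fin 2) ℝ) (b : Plane → Plane) (u : Plane → ℝ)
    (x : Plane) : ellipticL A b (fun y => -u y) x = -ellipticL A b u x := by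
  have h1 : ∀ (i : Fin 2) (w : Plane → ℝ),
      partialD i (fun y => -w y) = fun y => -partialD i w y := by
    intro i w; ext y; simp [partialD, fderiv_fun_neg]
  simp only [ellipticL, h1, Fin.sum_univ_two]
  ring

namespace SpiralDomain

variable {D : SpiralDomain} {A : Plane → Matrix (Fin 2) (Fin 2) ℝ} {b : Plane → Plane}
  {R ν : ℝ} {g : Plane → ℝ}

theorem Regular.neg {u : Plane → ℝ} (hu : D.Regular u) : D.Regular (fun x => -u x) :=
  ⟨hu.1.neg, hu.2.neg⟩

theorem isCompact_crossSection (D : SpiralDomain) (θ : ℝ) : IsCompact (D.crossSection θ) := by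
  have hc : Continuous fun r : ℝ => polarPt r θ := by
    unfold polarPt
    refine (PiLp.continuous_toLp 2 _).comp ?_
    fun_prop
  have : D.crossSection θ = (fun r => polarPt r θ) '' Icc (D.r₁ θ) (D.r₂ θ) := by
    ext x
    constructor
    · rintro ⟨r, h1, h2, rfl⟩; exact ⟨r, ⟨h1, h2⟩, rfl⟩
    · rintro ⟨r, ⟨h1, h2⟩, rfl⟩; exact ⟨r, h1, h2, rfl⟩
  rw [this]
  exact isCompact_Icc.image hc

theorem le_crossMax {v : Plane → ℝ} (hv : ContinuousOn v D.UTilde) {r θ : ℝ} (hθ : D.θ₀ ≤ θ)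
    (h1 : D.r₁ θ ≤ r) (h2 : r ≤ D.r₂ θ) : v (polarPt r θ) ≤ D.crossMax v θ := by
  have hsub : D.crossSection θ ⊆ D.UTilde := by
    rintro x ⟨r, h1, h2, rfl⟩; exact ⟨r, θ, hθ, h1, h2, rfl⟩
  exact le_csSup ((D.isCompact_crossSection θ).image_of_continuousOn (hv.mono hsub)).bddAbove
    ⟨_, ⟨r, h1, h2, rfl⟩, rfl⟩

theorem crossMax_le {v : Plane → ℝ} {θ k : ℝ} (hθ : D.θ₀ ≤ θ)
    (h : ∀ r, D.r₁ θ ≤ r → r ≤ D.r₂ θ → v (polarPt r θ) ≤ k) : D.crossMax v θ ≤ k := by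
  refine csSup_le ⟨_, _, ⟨D.r₁ θ, le_rfl, (D.r₁_lt_r₂ θ hθ).le, rfl⟩, rfl⟩ ?_
  rintro _ ⟨_, ⟨r, h1, h2, rfl⟩, rfl⟩
  exact h r h1 h2

theorem crossMax_nonneg {v : Plane → ℝ} (hv : ∀ x, 0 ≤ v x) (θ : ℝ) : 0 ≤ D.crossMax v θ := by
  refine Real.sSup_nonneg ?_
  rintro _ ⟨x, -, rfl⟩
  exact hv x

theorem inner_mem_γ (D : SpiralDomain) {θ : ℝ} (hθ : D.θ₀ ≤ θ) : polarPt (D.r₁ θ) θ ∈ D.γ :=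
  Or.inl ⟨θ, hθ, rfl⟩

theorem outer_mem_γ (D : SpiralDomain) {θ : ℝ} (hθ : D.θ₀ ≤ θ) : polarPt (D.r₂ θ) θ ∈ D.γ :=
  Or.inr ⟨θ, hθ, rfl⟩

theorem tendsto_exp_neg_mul_sub (hν : 0 < ν) (a : ℝ) :
    Tendsto (fun T : ℝ => Real.exp (-(ν * (T - a)))) atTop (𝓝 0) :=
  Real.tendsto_exp_neg_atTop_nhds_zero.comp
    ((tendsto_atTop_add_const_right _ (-a) tendsto_id).const_mul_atTop hν)

/-! ### The decay / growth dichotomy -/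

/-- The alternative between exponential decay and exponential growth for a non-negative function
that is a pointwise supremum of sub-solutions which are non-positive on `γ`. -/
theorem IsBarrier.decays_or_grows (hg : D.IsBarrier A b R ν g) {v : Plane → ℝ}
    (hv : ContinuousOn v D.UTilde) (hv0 : ∀ x, 0 ≤ v x)
    (H : ∀ x, v x ≤ 0 ∨ ∃ u : Plane → ℝ, D.Regular u ∧ (∀ y ∈ D.U, ellipticL A b u y ≤ 0) ∧
      (∀ y ∈ D.γ, u y ≤ 0) ∧ (∀ y, u y ≤ v y) ∧ v x ≤ u x) :
    D.Decays R ν v ∨ D.Grows ν v := by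
  by_cases hG : D.Grows ν v
  · exact Or.inr hG
  left
  have hR : 0 < R := by linarith [hg.one_le]
  have hm0 : ∀ θ, 0 ≤ D.crossMax v θ := crossMax_nonneg hv0
  have hsmall : ∀ C T, 0 < C → D.θ₀ ≤ T → ∃ T', T ≤ T' ∧
      D.crossMax v T' < C * Real.exp (ν * (T' - D.θ₀)) := by
    intro C T hC hT
    by_contra! h
    exact hG ⟨C, T, hC, hT, h⟩
  have est : ∀ r φ T, D.θ₀ ≤ φ → φ ≤ T → D.r₁ φ ≤ r → r ≤ D.r₂ φ → v (polarPt r φ) ≤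
      R * D.crossMax v D.θ₀ * Real.exp (-(ν * (φ - D.θ₀))) +
        R * D.crossMax v T * Real.exp (-(ν * (T - φ))) := by
    intro r φ T h1 h2 h3 h4
    rcases H (polarPt r φ) with h | ⟨u, hu, hL, hγ, hle, hx⟩
    · have := hm0 D.θ₀
      have := hm0 T
      exact h.trans (by positivity)
    · have := hg.two_sided_estimate hu (T' := T) (k := 0) (F := 0) le_rfl le_rfl (hm0 D.θ₀) (hm0 T)
        (fun r φ a1 a2 a3 => hL _ ⟨r, φ, a1, a2, a3, rfl⟩)
        (fun φ a => hγ _ (D.inner_mem_γ a)) (fun φ a => hγ _ (D.outer_mem_γ a))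
        (fun r a1 a2 => by rw [zero_add]; exact (hle _).trans (le_crossMax hv le_rfl a1 a2))
        (fun r a1 a2 => by rw [zero_add]; exact (hle _).trans (le_crossMax hv (h1.trans h2) a1 a2))
        h1 h2 h3 h4
      linarith
  have decay : ∀ θ, D.θ₀ ≤ θ →
      D.crossMax v θ ≤ R * D.crossMax v D.θ₀ * Real.exp (-(ν * (θ - D.θ₀))) := by
    intro θ hθ
    refine crossMax_le hθ fun r h3 h4 => le_of_forall_pos_le_add fun ε hε => ?_
    -- The constant is tuned so that the far-end term at `θ` is at most `ε`, whatever `T` turns out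
    -- to be.
    obtain ⟨T, hT, hC⟩ := hsmall (ε / (R * Real.exp (ν * (θ - D.θ₀)))) θ (by positivity) hθ
    refine (est r θ T hθ hT h3 h4).trans (add_le_add le_rfl ?_)
    calc R * D.crossMax v T * Real.exp (-(ν * (T - θ)))
        ≤ R * (ε / (R * Real.exp (ν * (θ - D.θ₀))) * Real.exp (ν * (T - D.θ₀))) *
          Real.exp (-(ν * (T - θ))) := by gcongr
      _ = ε * (Real.exp (ν * (T - D.θ₀)) * Real.exp (-(ν * (T - θ))) /
          Real.exp (ν * (θ - D.θ₀))) := by field_simp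
      _ = ε := by
        rw [← Real.exp_add, ← Real.exp_sub]
        have : ν * (T - D.θ₀) + -(ν * (T - θ)) - ν * (θ - D.θ₀) = 0 := by ring
        rw [this, Real.exp_zero, mul_one]
  refine ⟨?_, decay⟩
  rintro x ⟨r, φ, h1, h3, h4, rfl⟩
  rcases H (polarPt r φ) with h | ⟨u, hu, hL, hγ, hle, hx⟩
  · exact h.trans (hm0 _)
  refine hx.trans (le_of_forall_pos_le_add fun ε hε => ?_)
  have hlim : Tendsto (fun T => R * D.crossMax v D.θ₀ * Real.exp (-(ν * (T - D.θ₀)))) atTop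
      (𝓝 0) := by
    simpa using (tendsto_exp_neg_mul_sub hg.rate_pos D.θ₀).const_mul (R * D.crossMax v D.θ₀)
  obtain ⟨T, hT1, hT2⟩ := ((hlim.eventually_le_const hε).and (eventually_ge_atTop φ)).exists
  -- The decay bound alone would lose a factor `R`. Since it makes the values at a far `T` at most
  -- `ε`, comparison with the constant level `k`, with `m = m' = 0`, gives the bound with constant
  -- `1`.
  have hk : 0 ≤ D.crossMax v D.θ₀ + ε := by linarith [hm0 D.θ₀]
  have := hg.two_sided_estimate hu (T' := T) (k := D.crossMax v D.θ₀ + ε) (F := 0) (m := 0)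
    (m' := 0) le_rfl le_rfl le_rfl le_rfl
    (fun r φ a1 a2 a3 => hL _ ⟨r, φ, a1, a2, a3, rfl⟩)
    (fun φ a => (hγ _ (D.inner_mem_γ a)).trans hk) (fun φ a => (hγ _ (D.outer_mem_γ a)).trans hk)
    (fun r a1 a2 => by linarith [hle (polarPt r D.θ₀), le_crossMax hv le_rfl a1 a2])
    (fun r a1 a2 => by
      linarith [hle (polarPt r T), le_crossMax hv (h1.trans hT2) a1 a2, decay T (h1.trans hT2),
        hm0 D.θ₀])
    h1 hT2 h3 h4
  simpa using this

/-- Neither `u⁺` nor `|u|` need be `C²`, but at each point the first equals `0` or `u`, and the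
second equals `u` or `-u`, with these functions lying below it everywhere. -/
theorem IsBarrier.dichotomyConstants (hg : D.IsBarrier A b R ν g) :
    D.DichotomyConstants A b R ν := by
  refine ⟨by linarith [hg.one_le], hg.rate_pos, fun u hu hL hγ => ?_, fun u hu hL hγ => ?_⟩
  · refine hg.decays_or_grows (continuousOn_const.sup hu.2) (fun x => le_max_left _ _) fun x => ?_
    rcases le_total (u x) 0 with h | h
    · exact Or.inl (max_le le_rfl h)
    · exact Or.inr ⟨u, hu, hL, hγ, fun y => le_max_right _ _, max_le h le_rfl⟩
  · refine hg.decays_or_grows hu.2.abs (fun x => abs_nonneg _) fun x => Or.inr ?_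
    rcases le_total 0 (u x) with h | h
    · exact ⟨u, hu, fun y hy => (hL y hy).le, fun y hy => (hγ y hy).le, fun y => le_abs_self _,
        (abs_of_nonneg h).le⟩
    · exact ⟨fun y => -u y, hu.neg, fun y hy => by rw [ellipticL_neg, hL y hy, neg_zero],
        fun y hy => by simp [hγ y hy], fun y => neg_le_abs _, (abs_of_nonpos h).le⟩

/-! ### Estimates below exponential growth -/

/-- A sub-solution below exponential growth on the portion `θ ≥ T` of the spiral is controlled by
its lateral boundary values, the right hand side and its initial values. -/
theorem IsBarrier.one_sided_estimate (hg : D.IsBarrier A b R ν g) {u : Plane → ℝ}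
    (hu : D.Regular u) (hgrowth : D.BelowExpGrowth u) {T k F m : ℝ} (hT : D.θ₀ ≤ T) (hk : 0 ≤ k)
    (hF : 0 ≤ F) (hm : 0 ≤ m)
    (hL : ∀ r φ, T < φ → D.r₁ φ < r → r < D.r₂ φ → ellipticL A b u (polarPt r φ) ≤ F)
    (hin : ∀ φ, T ≤ φ → u (polarPt (D.r₁ φ) φ) ≤ k)
    (hout : ∀ φ, T ≤ φ → u (polarPt (D.r₂ φ) φ) ≤ k)
    (hstart : ∀ r, D.r₁ T ≤ r → r ≤ D.r₂ T → u (polarPt r T) ≤ k + m)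
    {r φ : ℝ} (h1 : T ≤ φ) (h3 : D.r₁ φ ≤ r) (h4 : r ≤ D.r₂ φ) :
    u (polarPt r φ) ≤ k + R * F + R * m * Real.exp (-(ν * (φ - T))) := by
  -- The far-end term is `R exp(νφ)` times `exp(-νT') max |u|` over the section at `T'`, so growth
  -- below the barrier's own rate `ν` makes it vanish as `T' → ∞`.
  have hlim := ((hgrowth ν hg.rate_pos).const_mul (R * Real.exp (ν * φ))).const_add
    (k + R * F + R * m * Real.exp (-(ν * (φ - T))))
  rw [mul_zero, add_zero] at hlim
  refine ge_of_tendsto hlim ?_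
  filter_upwards [eventually_ge_atTop φ] with T' hT'
  refine (hg.two_sided_estimate hu hT hF hm
    (crossMax_nonneg (D := D) (fun x => abs_nonneg (u x)) T') hL hin hout hstart (fun r a1 a2 => ?_) h1 hT' h3 h4).trans (le_of_eq ?_)
  · have := le_crossMax (v := fun x => |u x|) hu.2.abs (hT.trans (h1.trans hT')) a1 a2
    linarith [le_abs_self (u (polarPt r T'))]
  · have : Real.exp (-(ν * (T' - φ))) = Real.exp (ν * φ) * Real.exp (-(ν * T')) := by
      rw [← Real.exp_add]; ring_nf
    rw [this]; ring

theorem IsBarrier.crossMax_abs_le (hg : D.IsBarrier A b R ν g) {u : Plane → ℝ}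
    (hu : D.Regular u) (hgrowth : D.BelowExpGrowth u) {T k F m : ℝ} (hT : D.θ₀ ≤ T) (hk : 0 ≤ k)
    (hF : 0 ≤ F) (hm : 0 ≤ m)
    (hL : ∀ r φ, T < φ → D.r₁ φ < r → r < D.r₂ φ → |ellipticL A b u (polarPt r φ)| ≤ F)
    (hin : ∀ φ, T ≤ φ → |u (polarPt (D.r₁ φ) φ)| ≤ k)
    (hout : ∀ φ, T ≤ φ → |u (polarPt (D.r₂ φ) φ)| ≤ k)
    (hstart : ∀ r, D.r₁ T ≤ r → r ≤ D.r₂ T → |u (polarPt r T)| ≤ k + m)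
    {φ : ℝ} (h1 : T ≤ φ) :
    D.crossMax (fun x => |u x|) φ ≤ k + R * F + R * m * Real.exp (-(ν * (φ - T))) := by
  refine crossMax_le (hT.trans h1) fun r h3 h4 => abs_le'.2 ⟨?_, ?_⟩
  · exact hg.one_sided_estimate hu hgrowth hT hk hF hm
      (fun r φ a1 a2 a3 => (le_abs_self _).trans (hL r φ a1 a2 a3))
      (fun φ a => (le_abs_self _).trans (hin φ a)) (fun φ a => (le_abs_self _).trans (hout φ a))
      (fun r a1 a2 => (le_abs_self _).trans (hstart r a1 a2)) h1 h3 h4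
  · have hgrowth' : D.BelowExpGrowth fun x => -u x := by
      simpa only [BelowExpGrowth, abs_neg] using hgrowth
    exact hg.one_sided_estimate hu.neg hgrowth' hT hk hF hm
      (fun r φ a1 a2 a3 => by rw [ellipticL_neg]; exact (neg_le_abs _).trans (hL r φ a1 a2 a3))
      (fun φ a => (neg_le_abs _).trans (hin φ a)) (fun φ a => (neg_le_abs _).trans (hout φ a))
      (fun r a1 a2 => (neg_le_abs _).trans (hstart r a1 a2)) h1 h3 h4

theorem sSup_abs_image_nonneg (w : Plane → ℝ) (s : Set Plane) :
    0 ≤ sSup ((fun x => |w x|) '' s) := by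
  refine Real.sSup_nonneg ?_
  rintro _ ⟨x, -, rfl⟩
  exact abs_nonneg _

/-- The initial values are forgotten exponentially fast. -/
theorem IsBarrier.crossMax_abs_le_global (hg : D.IsBarrier A b R ν g) {u f : Plane → ℝ}
    (hu : D.Regular u) (hgrowth : D.BelowExpGrowth u)
    (hB : BddAbove ((fun x => |u x|) '' D.γ)) (hf : BddAbove ((fun x => |f x|) '' D.U))
    (hL : ∀ x ∈ D.U, ellipticL A b u x = f x) {θ : ℝ} (hθ : D.θ₀ ≤ θ) :
    D.crossMax (fun x => |u x|) θ ≤ D.MB u + R * D.Mf f +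
      R * D.crossMax (fun x => |u x|) D.θ₀ * Real.exp (-(ν * (θ - D.θ₀))) := by
  have hMB : 0 ≤ D.MB u := sSup_abs_image_nonneg u _
  have hMf : 0 ≤ D.Mf f := sSup_abs_image_nonneg f _
  have hγ : ∀ x ∈ D.γ, |u x| ≤ D.MB u := fun x hx => le_csSup hB ⟨x, hx, rfl⟩
  refine hg.crossMax_abs_le hu hgrowth le_rfl hMB hMf (crossMax_nonneg (fun x => abs_nonneg _) _)
    (fun r φ a1 a2 a3 => ?_) (fun φ a => hγ _ (D.inner_mem_γ a))
    (fun φ a => hγ _ (D.outer_mem_γ a)) (fun r a1 a2 => ?_) hθ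
  · have hx : polarPt r φ ∈ D.U := ⟨r, φ, a1, a2, a3, rfl⟩
    rw [hL _ hx]
    exact le_csSup hf ⟨_, hx, rfl⟩
  · have := le_crossMax (v := fun x => |u x|) hu.2.abs le_rfl a1 a2
    linarith

/-- In the limit only the lateral boundary values and the right hand side near the limit circle
matter. -/
theorem IsBarrier.limsup_crossMax_abs_le (hg : D.IsBarrier A b R ν g) {u f : Plane → ℝ}
    (hu : D.Regular u) (hgrowth : D.BelowExpGrowth u)
    (hB : BddAbove ((fun x => |u x|) '' D.γ)) (hf : BddAbove ((fun x => |f x|) '' D.U))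
    (hL : ∀ x ∈ D.U, ellipticL A b u x = f x) :
    limsup (fun θ => D.crossMax (fun x => |u x|) θ) atTop ≤
      limsup (fun θ => D.MBAt u θ) atTop + R * limsup (fun θ => D.MfAt f θ) atTop := by
  have hR : 0 < R := by linarith [hg.one_le]
  have bB : ∀ θ, BddAbove ((fun x => |u x|) '' (D.γ ∩ D.crossSection θ)) := fun θ =>
    hB.mono (image_mono inter_subset_left)
  have bf : ∀ θ, BddAbove ((fun x => |f x|) '' (D.U ∩ D.crossSection θ)) := fun θ =>
    hf.mono (image_mono inter_subset_left)
  have hMB : ∀ θ, 0 ≤ D.MBAt u θ := fun θ => sSup_abs_image_nonneg u _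
  have hMf : ∀ θ, 0 ≤ D.MfAt f θ := fun θ => sSup_abs_image_nonneg f _
  have hMB' : IsBoundedUnder (· ≤ ·) atTop (fun θ => D.MBAt u θ) := by
    refine isBoundedUnder_of ⟨D.MB u, fun θ => Real.sSup_le ?_ (sSup_abs_image_nonneg u _)⟩
    rintro _ ⟨x, hx, rfl⟩
    exact le_csSup hB ⟨x, hx.1, rfl⟩
  have hMf' : IsBoundedUnder (· ≤ ·) atTop (fun θ => D.MfAt f θ) := by
    refine isBoundedUnder_of ⟨D.Mf f, fun θ => Real.sSup_le ?_ (sSup_abs_image_nonneg f _)⟩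
    rintro _ ⟨x, hx, rfl⟩
    exact le_csSup hf ⟨x, hx.1, rfl⟩
  set P := limsup (fun θ => D.MBAt u θ) atTop with hP
  set Q := limsup (fun θ => D.MfAt f θ) atTop with hQ
  refine le_of_forall_pos_le_add fun ε hε => ?_
  -- Three errors add up: `η` from the boundary values, `Rη` from the right hand side, and `η` from
  -- the initial values at `T`.
  set η := ε / (2 + R) with hη
  have hη0 : 0 < η := by positivity
  have e1 : ∀ᶠ θ in atTop, D.MBAt u θ < P + η :=
    eventually_lt_of_limsup_lt (lt_add_of_pos_right _ hη0) hMB'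
  have e2 : ∀ᶠ θ in atTop, D.MfAt f θ < Q + η :=
    eventually_lt_of_limsup_lt (lt_add_of_pos_right _ hη0) hMf'
  obtain ⟨T₁, hT₁⟩ := eventually_atTop.1 (e1.and e2)
  set T := max T₁ D.θ₀ with hT
  have hT0 : D.θ₀ ≤ T := le_max_right _ _
  have hTT : ∀ θ, T ≤ θ → D.MBAt u θ < P + η ∧ D.MfAt f θ < Q + η := fun θ h =>
    hT₁ θ ((le_max_left _ _).trans h)
  have hP0 : 0 ≤ P + η := (hMB T).trans (hTT T le_rfl).1.le
  have hQ0 : 0 ≤ Q + η := (hMf T).trans (hTT T le_rfl).2.le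
  set m := D.crossMax (fun x => |u x|) T with hm
  have hm0 : 0 ≤ m := crossMax_nonneg (fun x => abs_nonneg _) _
  have key : ∀ φ, T ≤ φ → D.crossMax (fun x => |u x|) φ ≤
      (P + η) + R * (Q + η) + R * m * Real.exp (-(ν * (φ - T))) := by
    intro φ hφ
    refine hg.crossMax_abs_le hu hgrowth hT0 hP0 hQ0 hm0 (fun r φ a1 a2 a3 => ?_) (fun φ a => ?_)
      (fun φ a => ?_) (fun r a1 a2 => ?_) hφ
    · have hx : polarPt r φ ∈ D.U := ⟨r, φ, hT0.trans_lt a1, a2, a3, rfl⟩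
      rw [hL _ hx]
      exact (le_csSup (bf φ) ⟨_, ⟨hx, r, a2.le, a3.le, rfl⟩, rfl⟩).trans (hTT φ a1.le).2.le
    · exact (le_csSup (bB φ) ⟨_, ⟨D.inner_mem_γ (hT0.trans a), D.r₁ φ, le_rfl,
        (D.r₁_lt_r₂ φ (hT0.trans a)).le, rfl⟩, rfl⟩).trans (hTT φ a).1.le
    · exact (le_csSup (bB φ) ⟨_, ⟨D.outer_mem_γ (hT0.trans a), D.r₂ φ,
        (D.r₁_lt_r₂ φ (hT0.trans a)).le, le_rfl, rfl⟩, rfl⟩).trans (hTT φ a).1.le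
    · have := le_crossMax (v := fun x => |u x|) hu.2.abs hT0 a1 a2
      linarith
  have hlim : Tendsto (fun θ => R * m * Real.exp (-(ν * (θ - T)))) atTop (𝓝 0) := by
    simpa using (tendsto_exp_neg_mul_sub hg.rate_pos T).const_mul (R * m)
  refine limsup_le_of_le (isCoboundedUnder_le_of_le atTop (x := 0)
    fun θ => crossMax_nonneg (fun x => abs_nonneg _) _) ?_
  filter_upwards [hlim.eventually_le_const hη0, eventually_ge_atTop T] with θ h1 h2
  have h3 : η * (2 + R) = ε := div_mul_cancel₀ _ (by positivity)
  linarith [key θ h2]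

end SpiralDomain

theorem theorem5p3 (D : SpiralDomain) (A : Plane → Matrix (Fin 2) (Fin 2) ℝ) (b : Plane → Plane)
    (c₀ M₁ M₂ : ℝ) (hA : IsUniformlyElliptic D.U A c₀ M₁) (hb : IsBoundedDrift D.U b M₂) :
    ∃ Cstar ν : ℝ, D.DichotomyConstants A b Cstar ν ∧
      ∃ K₁ : ℝ, 0 < K₁ ∧
        ∀ u f : Plane → ℝ, D.Regular u → D.BelowExpGrowth u →
          BddAbove ((fun x => |u x|) '' D.γ) → BddAbove ((fun x => |f x|) '' D.U) →
          (∀ x ∈ D.U, ellipticL A b u x = f x) →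
          (∀ θ : ℝ, D.θ₀ ≤ θ →
            D.crossMax (fun x => |u x|) θ ≤
              D.MB u + K₁ * D.Mf f +
                Cstar * (D.crossMax (fun x => |u x|) D.θ₀ + D.MB u + K₁ * D.Mf f) *
                  Real.exp (-(ν * (θ - D.θ₀)))) ∧
          limsup (fun θ => D.crossMax (fun x => |u x|) θ) atTop ≤
            limsup (fun θ => D.MBAt u θ) atTop + K₁ * limsup (fun θ => D.MfAt f θ) atTop := by
  obtain ⟨R, ν, g, hg⟩ := D.exists_isBarrier hA hb
  have hR : 0 < R := by linarith [hg.one_le]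
  refine ⟨R, ν, hg.dichotomyConstants, R, hR, fun u f hu hgrowth hB hf hL =>
    ⟨fun θ hθ => ?_, hg.limsup_crossMax_abs_le hu hgrowth hB hf hL⟩⟩
  -- The barrier estimate has only the initial maximum in front of the exponential; the remaining
  -- summands there are non-negative.
  refine (hg.crossMax_abs_le_global hu hgrowth hB hf hL hθ).trans ?_
  have hMB : 0 ≤ D.MB u := SpiralDomain.sSup_abs_image_nonneg u _
  have hMf : 0 ≤ D.Mf f := SpiralDomain.sSup_abs_image_nonneg f _
  have hle : D.crossMax (fun x => |u x|) D.θ₀ ≤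
      D.crossMax (fun x => |u x|) D.θ₀ + D.MB u + R * D.Mf f := by
    have : 0 ≤ R * D.Mf f := by positivity
    linarith
  gcongr
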